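/- Let $G$ be a finite-dimensional real (smooth) Lie group with neutral element $1$, let $\mathfrak{X}(G)$ be the space of smooth vector fields on $G$, and write $L_g(x)=gx$. A (smooth) Koszul connection $\nabla$ on $TG$ is called left invariant if $L_g^*(\nabla_XY)=\nabla_{L_g^*X}(L_g^*Y)$ for all $g\in G$ and $X,Y\in\mathfrak{X}(G)$. Its torsion and curvature are $T(X,Y)=\nabla_XY-\nabla_YX-[X,Y]$ and $R(X,Y)Z=\nabla_X\nabla_YZ-\nabla_Y\nabla_XZ-\nabla_{[X,Y]}Z$. A left invariant locally flat (affine) structure on $G$ is a left invariant Koszul connection with $T=0$ and $R=0$. For a smooth vector field $X$ put $$(\nabla^2X)(Y,Z)=\nabla_Y\nabla_ZX-\nabla_{\nabla_YZ}X .$$ Let $J_\nabla$ be the space of all $X\in\mathfrak{X}(G)$ with $\nabla^2X=0$, let $\mathcal{T}_\nabla G(1)=\{X(1): X\in J_\nabla\}\subset T_1G$, and let $r^b(\nabla)=\dim\mathcal{T}_\nabla G(1)$. Define $$r^b(G)=\min_{\nabla}\{\dim G-r^b(\nabla)\},$$ the minimum being over all left invariant torsion-free Koszul connections $\nabla$ on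 $G$. **Theorem.** The following assertions are equivalent: (1) $r^b(G)=0$; (2) $G$ admits a left invariant locally flat structure. The same equivalence holds if $\mathcal{T}_\nabla G(1)$ is replaced in the definition of $r^b$ by the subspace of $T_1G$ spanned by the values at $1$ of the solutions of $\nabla^2X=0$ that are defined on some open neighbourhood of $1$. -/

import Mathlib

open scoped Manifold ContDiff

noncomputable section

namespace LeftInvariantGauge

universe u v

variable {E : Type u} [NormedAddCommGroup E] [NormedSpace ℝ E]
  {G : Type v} [TopologicalSpace G] [ChartedSpace E G]

/-- Vector fields on the manifold `G` (no regularity imposed). -/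
abbrev VField (E : Type u) [NormedAddCommGroup E] [NormedSpace ℝ E]
    (G : Type v) [TopologicalSpace G] [ChartedSpace E G] : Type (max u v) :=
  ∀ x : G, TangentSpace 𝓘(ℝ, E) x

/-- The vector field `X` is of class `C^∞` on the set `U`. -/
def SmoothOn [IsManifold 𝓘(ℝ, E) 1 G] (X : VField E G) (U : Set G) : Prop :=
  ContMDiffOn 𝓘(ℝ, E) 𝓘(ℝ, E).tangent ∞
    (fun x => (⟨x, X x⟩ : TangentBundle 𝓘(ℝ, E) G)) U

/-- Koszul connections (covariant derivatives on the tangent bundle) of `G`;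
`D Y x (X x)` is the value at `x` of `∇_X Y`. -/
abbrev Connection (E : Type u) [NormedAddCommGroup E] [NormedSpace ℝ E]
    (G : Type v) [TopologicalSpace G] [ChartedSpace E G] [IsManifold 𝓘(ℝ, E) 1 G] :
    Type (max u v) :=
  CovariantDerivative 𝓘(ℝ, E) E (TangentSpace 𝓘(ℝ, E) : G → Type u)

/-- The vector field `∇_X Y`. -/
def nabla [IsManifold 𝓘(ℝ, E) 1 G] (D : Connection E G) (X Y : VField E G) : VField E G :=
  fun x => D Y x (X x)

/-- Curvature: `R(X, Y) Z = ∇_X ∇_Y Z - ∇_Y ∇_X Z - ∇_[X,Y] Z`. -/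
def curvature [IsManifold 𝓘(ℝ, E) 1 G] (D : Connection E G) (X Y Z : VField E G) :
    VField E G :=
  nabla D X (nabla D Y Z) - nabla D Y (nabla D X Z)
    - nabla D (VectorField.mlieBracket 𝓘(ℝ, E) X Y) Z

/-- `(∇²X)(Y, Z) = ∇_Y ∇_Z X - ∇_(∇_Y Z) X`. -/
def nablaSq [IsManifold 𝓘(ℝ, E) 1 G] (D : Connection E G) (X Y Z : VField E G) :
    VField E G :=
  nabla D Y (nabla D Z X) - nabla D (nabla D Y Z) X

/-- The curvature tensor of `D` vanishes. -/
def IsFlat [IsManifold 𝓘(ℝ, E) 1 G] (D : Connection E G) : Prop :=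
  ∀ X Y Z : VField E G, SmoothOn X Set.univ → SmoothOn Y Set.univ → SmoothOn Z Set.univ →
    curvature D X Y Z = 0

/-- `X` is a smooth solution of `∇²X = 0` on `U` (values of `X` off `U` are irrelevant
when `U` is open). -/
def IsSolutionOn [IsManifold 𝓘(ℝ, E) 1 G] (D : Connection E G) (X : VField E G)
    (U : Set G) : Prop :=
  SmoothOn X U ∧
    ∀ Y Z : VField E G, SmoothOn Y Set.univ → SmoothOn Z Set.univ →
      ∀ x ∈ U, nablaSq D X Y Z x = 0

variable [Group G]

/-- Left invariance: `(L_g)^* (∇_X Y) = ∇_((L_g)^* X) ((L_g)^* Y)` for every `g` and all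
smooth vector fields, with `L_g x = g * x`. -/
def IsLeftInvariant [IsManifold 𝓘(ℝ, E) 1 G] (D : Connection E G) : Prop :=
  ∀ (g : G) (X Y : VField E G), SmoothOn X Set.univ → SmoothOn Y Set.univ →
    VectorField.mpullback 𝓘(ℝ, E) 𝓘(ℝ, E) (fun x => g * x) (nabla D X Y) =
      nabla D (VectorField.mpullback 𝓘(ℝ, E) 𝓘(ℝ, E) (fun x => g * x) X)
        (VectorField.mpullback 𝓘(ℝ, E) 𝓘(ℝ, E) (fun x => g * x) Y)

/-- The subspace of `T_1 G` spanned by the values at `1` of the solutions of `∇²X = 0` that are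
defined on all of `G`. -/
def solutionSpan [IsManifold 𝓘(ℝ, E) 1 G] (D : Connection E G) :
    Submodule ℝ (TangentSpace 𝓘(ℝ, E) (1 : G)) :=
  Submodule.span ℝ {w | ∃ X : VField E G, IsSolutionOn D X Set.univ ∧ X 1 = w}

/-- The subspace of `T_1 G` spanned by the values at `1` of the solutions of `∇²X = 0` that are
defined on some open neighbourhood of `1`. -/
def localSolutionSpan [IsManifold 𝓘(ℝ, E) 1 G] (D : Connection E G) :
    Submodule ℝ (TangentSpace 𝓘(ℝ, E) (1 : G)) :=
  Submodule.span ℝ {w | ∃ (U : Set G) (X : VField E G),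
    IsOpen U ∧ (1 : G) ∈ U ∧ IsSolutionOn D X U ∧ X 1 = w}

section FiniteDim

variable [FiniteDimensional ℝ E] [LieGroup 𝓘(ℝ, E) ∞ G]

/-- `D` is a smooth left invariant torsion-free (symmetric) connection. -/
structure IsSLC (D : Connection E G) : Prop where
  smooth : CovariantDerivative.ContMDiffCovariantDerivative D ∞
  leftInvariant : IsLeftInvariant D
  torsionFree : D.torsion = 0

variable (E G)

/-- `r^b(G)`: the minimum of `dim G - dim (solutionSpan D)` over all smooth left invariant
torsion-free connections `D` (an infimum in `ℕ∞`, so attained). -/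
def rb : ℕ∞ :=
  ⨅ D : {D : Connection E G // IsSLC D},
    ((Module.finrank ℝ E - Module.finrank ℝ (solutionSpan D.1) : ℕ) : ℕ∞)

/-- The variant of `r^b(G)` in which solutions need only be defined near `1`. -/
def rbLocal : ℕ∞ :=
  ⨅ D : {D : Connection E G // IsSLC D},
    ((Module.finrank ℝ E - Module.finrank ℝ (localSolutionSpan D.1) : ℕ) : ℕ∞)

/-- `G` carries a left invariant locally flat structure: a smooth left invariant connection with
vanishing torsion and vanishing curvature. -/
def AdmitsLeftInvariantLocallyFlat : Prop :=
  ∃ D : Connection E G, IsSLC D ∧ IsFlat D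

end FiniteDim

end LeftInvariantGauge

end

/-!
If `X` is a local solution of `∇²X = 0`, then torsion-freeness gives
`R(Y, Z)X = (∇²X)(Y, Z) - (∇²X)(Z, Y) = 0`. The curvature is a tensor, so it vanishes at `1` as soon
as the values of the local solutions span `T_1 G`, and then everywhere by left invariance.

Conversely, a right invariant field `V` commutes with every left invariant field `Y`: on `G × G` the
fields `(V, 0)` and `(0, Y)` commute, and multiplication `G × G → G` relates them to `V` and `Y`.
Hence `∇_Y V = ∇_V Y` when the torsion vanishes, and `(∇²V)(Y, Z) = -R(V, Y)Z` for left invariant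
`Y`, `Z`. If `∇` is flat, then all right invariant fields are global solutions, and their values at
`1` fill `T_1 G`.
-/

noncomputable section

namespace LeftInvariantGauge

section LieBracket
open VectorField Set Filter Topology

variable {𝕜 : Type*} [NontriviallyNormedField 𝕜]
  {E : Type*} [NormedAddCommGroup E] [NormedSpace 𝕜 E] {H : Type*} [TopologicalSpace H]
  {I : ModelWithCorners 𝕜 E H} {M : Type*} [TopologicalSpace M] [ChartedSpace H M]
  {F : Type*} [NormedAddCommGroup F] [NormedSpace 𝕜 F] {c : M → F}
  {X Y : ∀ x : M, TangentSpace I x} {x : M} {z : E}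

lemma mvfderiv_apply_eq_fderivWithin (hc : MDiffAt c x) (v : TangentSpace I x) :
    d% c x v = fderivWithin 𝕜 (c ∘ (extChartAt I x).symm) (range I) (extChartAt I x x) v := by
  rw [hc.mvfderiv]
  rfl

lemma fderivWithin_comp_extChartAt_symm_apply [IsManifold I 1 M]
    (hz : z ∈ (extChartAt I x).target) (hc : MDiffAt c ((extChartAt I x).symm z)) :
    fderivWithin 𝕜 (c ∘ (extChartAt I x).symm) (range I) z
        (mpullbackWithin 𝓘(𝕜, E) I (extChartAt I x).symm X (range I) z) =
      d% c ((extChartAt I x).symm z) (X ((extChartAt I x).symm z)) := by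
  have hchain := mfderiv_comp_mfderivWithin z hc (mdifferentiableWithinAt_extChartAt_symm hz)
    (I.uniqueMDiffOn _ (extChartAt_target_subset_range x hz))
  rw [← mfderivWithin_eq_fderivWithin, mpullbackWithin_apply]
  refine congr($hchain _).trans (congrArg (mfderiv% c _) ?_)
  exact (isInvertible_mfderivWithin_extChartAt_symm hz).self_apply_inverse _

lemma mfderiv_extChartAt_self_apply [IsManifold I 1 M] (v : TangentSpace I x) :
    mfderiv% (extChartAt I x) x v = v := by
  rw [mfderiv_extChartAt_self]
  rfl

lemma mfderiv_extChartAt_self_inverse_apply [IsManifold I 1 M] (v : E) :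
    (mfderiv% (extChartAt I x) x).inverse v = v := by
  rw [mfderiv_extChartAt_self]
  exact congr($(ContinuousLinearMap.inverse_id (R := 𝕜) (M := E)) v)

lemma mlieBracket_eq_lieBracketWithin_extChartAt [IsManifold I 1 M] :
    mlieBracket I X Y x = lieBracketWithin 𝕜
      (mpullbackWithin 𝓘(𝕜, E) I (extChartAt I x).symm X (range I))
      (mpullbackWithin 𝓘(𝕜, E) I (extChartAt I x).symm Y (range I))
      (range I) (extChartAt I x x) := by
  rw [← mlieBracketWithin_univ, mlieBracketWithin_apply, preimage_univ, univ_inter]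
  exact mfderiv_extChartAt_self_inverse_apply _

lemma mpullbackWithin_extChartAt_symm_self [IsManifold I 1 M] :
    mpullbackWithin 𝓘(𝕜, E) I (extChartAt I x).symm X (range I) (extChartAt I x x) = X x := by
  have h := (eventuallyEq_mpullback_mpullbackWithin_extChartAt (I := I) (s := univ) (x := x)
    X).self_of_nhdsWithin (mem_univ x)
  rw [mpullback_apply] at h
  exact (h.trans (mfderiv_extChartAt_self_inverse_apply _)).symm

lemma mdifferentiableAt_of_comp_extChartAt_symm [IsManifold I 1 M]
    (hc : DifferentiableWithinAt 𝕜 (c ∘ (extChartAt I x).symm) (range I) (extChartAt I x x)) :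
    MDiffAt c x := by
  have hφ : MDiffAt (extChartAt I x) x := mdifferentiableAt_extChartAt (mem_chart_source H x)
  have hcomp := hc.mdifferentiableWithinAt.comp x hφ.mdifferentiableWithinAt (s := univ)
    fun y _ => mem_range_self (chartAt H x y)
  refine (mdifferentiableWithinAt_univ.1 hcomp).congr_of_eventuallyEq ?_
  filter_upwards [extChartAt_source_mem_nhds (I := I) x] with y hy
  exact congrArg c ((extChartAt I x).left_inv hy).symm

variable {E' : Type*} [NormedAddCommGroup E'] [NormedSpace 𝕜 E']
  {H' : Type*} [TopologicalSpace H'] {J : ModelWithCorners 𝕜 E' H'}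
  {N : Type*} [TopologicalSpace N] [ChartedSpace H' N]
  {f : M → N} {X' Y' : ∀ y : N, TangentSpace J y}

lemma mvfderiv_congr {c' : M → F} (h : c =ᶠ[𝓝 x] c') : d% c x = d% c' x := by
  ext v
  exact congr($(h.mfderiv_eq (I := I)) v)

lemma mvfderiv_comp_apply_of_related {g : N → F} (hg : MDiffAt g (f x)) (hf : MDiffAt f x)
    (hXX' : mfderiv% f x (X x) = X' (f x)) :
    d% (g ∘ f) x (X x) = d% g (f x) (X' (f x)) := by
  rw [← hXX']
  exact congr($(mfderiv_comp x hg hf) (X x))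

variable {n : ℕ∞ω}

lemma eventually_mdifferentiableAt [IsManifold I 1 M] [IsManifold J 1 N] (hf : CMDiffAt n f x)
    (hn : 1 ≤ n) : ∀ᶠ y in 𝓝 x, MDiffAt f y :=
  ((contMDiffAt_iff_contMDiffAt_nhds (by simp)).1 (hf.of_le hn)).mono
    fun _ hy => hy.mdifferentiableAt one_ne_zero

lemma fderivWithin_comp_extChartAt_symm_eventuallyEq [IsManifold I 1 M]
    (hc : CMDiffAt n c x) (hn : 1 ≤ n) :
    (fun z => fderivWithin 𝕜 (c ∘ (extChartAt I x).symm) (range I) z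
        (mpullbackWithin 𝓘(𝕜, E) I (extChartAt I x).symm X (range I) z))
      =ᶠ[𝓝[range I] (extChartAt I x x)] (fun y => d% c y (X y)) ∘ (extChartAt I x).symm := by
  have hsymm : Tendsto (extChartAt I x).symm (𝓝[range I] (extChartAt I x x)) (𝓝 x) := by
    simpa using (continuousAt_extChartAt_symm (I := I) x).continuousWithinAt.tendsto
  filter_upwards [hsymm.eventually (eventually_mdifferentiableAt hc hn),
    extChartAt_target_mem_nhdsWithin x] with z hcz hz
  exact fderivWithin_comp_extChartAt_symm_apply hz hcz

lemma contDiffWithinAt_comp_extChartAt_symm (hc : CMDiffAt n c x) :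
    ContDiffWithinAt 𝕜 n (c ∘ (extChartAt I x).symm) (range I) (extChartAt I x x) := by
  simpa using! (contMDiffAt_iff.1 hc).2

lemma differentiableWithinAt_mpullbackWithin_range [CompleteSpace E] [IsManifold I 2 M]
    (hX : MDiffAt (T% X) x) :
    DifferentiableWithinAt 𝕜 (mpullbackWithin 𝓘(𝕜, E) I (extChartAt I x).symm X (range I))
      (range I) (extChartAt I x x) := by
  simpa using MDifferentiableWithinAt.differentiableWithinAt_mpullbackWithin_vectorField
    (mdifferentiableWithinAt_univ.2 hX)

lemma mdifferentiableAt_mvfderiv_apply [CompleteSpace E] [IsManifold I 2 M] (hc : CMDiffAt n c x)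
    (hn : 2 ≤ n) (hX : MDiffAt (T% X) x) : MDiffAt (fun y => d% c y (X y)) x := by
  have hdc : DifferentiableWithinAt 𝕜 (fderivWithin 𝕜 (c ∘ (extChartAt I x).symm) (range I))
      (range I) (extChartAt I x x) :=
    ((contDiffWithinAt_comp_extChartAt_symm hc).fderivWithin_right (m := 1) I.uniqueDiffOn hn
      (mem_range_self _)).differentiableWithinAt one_ne_zero
  exact mdifferentiableAt_of_comp_extChartAt_symm <|
    (hdc.clm_apply (differentiableWithinAt_mpullbackWithin_range hX)).congr_of_eventuallyEq_of_mem
      (fderivWithin_comp_extChartAt_symm_eventuallyEq hc (one_le_two.trans hn)).symm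
      (mem_range_self _)

lemma mvfderiv_apply_mlieBracket [CompleteSpace E] [IsManifold I 2 M] (hc : CMDiffAt n c x)
    (hn : minSmoothness 𝕜 2 ≤ n) (hX : MDiffAt (T% X) x) (hY : MDiffAt (T% Y) x) :
    d% c x (mlieBracket I X Y x) =
      d% (fun y => d% c y (Y y)) x (X x) - d% (fun y => d% c y (X y)) x (Y x) := by
  have hn2 : 2 ≤ n := le_minSmoothness.trans hn
  have hbracket := fderivWithin_apply_lieBracket (contDiffWithinAt_comp_extChartAt_symm hc) hn
    I.uniqueDiffOn (I.range_subset_closure_interior (mem_range_self _)) (mem_range_self _)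
    (differentiableWithinAt_mpullbackWithin_range hY)
    (differentiableWithinAt_mpullbackWithin_range hX)
  have hiter (Z : ∀ x : M, TangentSpace I x) :=
    (fderivWithin_comp_extChartAt_symm_eventuallyEq (X := Z) hc
      (one_le_two.trans hn2)).fderivWithin_eq_of_mem (𝕜 := 𝕜) (mem_range_self _)
  rw [hiter, hiter, mpullbackWithin_extChartAt_symm_self, mpullbackWithin_extChartAt_symm_self]
    at hbracket
  rw [mvfderiv_apply_eq_fderivWithin (hc.mdifferentiableAt (two_pos.trans_le hn2).ne'),
    mvfderiv_apply_eq_fderivWithin (mdifferentiableAt_mvfderiv_apply hc hn2 hX),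
    mvfderiv_apply_eq_fderivWithin (mdifferentiableAt_mvfderiv_apply hc hn2 hY), ← hbracket,
    mlieBracket_eq_lieBracketWithin_extChartAt]

lemma mvfderiv_mvfderiv_comp_apply_of_related [CompleteSpace E'] [IsManifold I 1 M]
    [IsManifold J 2 N] {g : N → F} {W : ∀ x : M, TangentSpace I x} {W' : ∀ y : N, TangentSpace J y}
    (hg : CMDiffAt n g (f x)) (hf : CMDiffAt n f x) (hn : 2 ≤ n)
    (hX' : MDiffAt (T% X') (f x)) (hXX' : ∀ᶠ y in 𝓝 x, mfderiv% f y (X y) = X' (f y))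
    (hWW' : mfderiv% f x (W x) = W' (f x)) :
    d% (fun y => d% (g ∘ f) y (X y)) x (W x) = d% (fun y => d% g y (X' y)) (f x) (W' (f x)) := by
  have hn1 : 1 ≤ n := one_le_two.trans hn
  have hcomp : (fun y => d% (g ∘ f) y (X y)) =ᶠ[𝓝 x] (fun y => d% g y (X' y)) ∘ f := by
    filter_upwards [eventually_mdifferentiableAt hf hn1,
      hf.continuousAt.eventually (eventually_mdifferentiableAt hg hn1), hXX'] with y hfy hgy hy
    exact mvfderiv_comp_apply_of_related hgy hfy hy
  rw [mvfderiv_congr hcomp]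
  exact mvfderiv_comp_apply_of_related (mdifferentiableAt_mvfderiv_apply hg hn hX')
    (hf.mdifferentiableAt (zero_lt_one.trans_le hn1).ne') hWW'

lemma mfderiv_mlieBracket_of_related [CompleteSpace E] [CompleteSpace E']
    [IsManifold I 2 M] [IsManifold J (minSmoothness 𝕜 2) N]
    (hf : CMDiffAt (minSmoothness 𝕜 2) f x)
    (hX : MDiffAt (T% X) x) (hY : MDiffAt (T% Y) x)
    (hX' : MDiffAt (T% X') (f x)) (hY' : MDiffAt (T% Y') (f x))
    (hXX' : ∀ᶠ y in 𝓝 x, mfderiv% f y (X y) = X' (f y))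
    (hYY' : ∀ᶠ y in 𝓝 x, mfderiv% f y (Y y) = Y' (f y)) :
    mfderiv% f x (mlieBracket I X Y x) = mlieBracket J X' Y' (f x) := by
  have hn : 2 ≤ minSmoothness 𝕜 2 := le_minSmoothness
  have hn0 : minSmoothness 𝕜 2 ≠ 0 := (two_pos.trans_le hn).ne'
  have hφ : CMDiffAt (minSmoothness 𝕜 2) (extChartAt J (f x)) (f x) := contMDiffAt_extChartAt
  have hbracket := mvfderiv_apply_mlieBracket (hφ.comp x hf) le_rfl hX hY
  rw [mvfderiv_mvfderiv_comp_apply_of_related hφ hf hn hY' hYY' hXX'.self_of_nhds,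
    mvfderiv_mvfderiv_comp_apply_of_related hφ hf hn hX' hXX' hYY'.self_of_nhds,
    ← mvfderiv_apply_mlieBracket hφ le_rfl hX' hY'] at hbracket
  have hchain (v : TangentSpace I x) : d% (extChartAt J (f x) ∘ f) x v = mfderiv% f x v :=
    congr($(mfderiv_comp x (hφ.mdifferentiableAt hn0) (hf.mdifferentiableAt hn0)) v).trans
      (mfderiv_extChartAt_self_apply _)
  rw [← hchain, hbracket]
  exact mfderiv_extChartAt_self_apply _

variable {V V' : ∀ x : M, TangentSpace I x} {W W' : ∀ y : N, TangentSpace J y} {p : M × N}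

/-- The vector field on `M × N` with components `V` and `W`. -/
def prodVectorField (V : ∀ x : M, TangentSpace I x) (W : ∀ y : N, TangentSpace J y) :
    ∀ q : M × N, TangentSpace (I.prod J) q :=
  fun q => (V q.1, W q.2)

lemma mdifferentiableAt_prodVectorField [IsManifold I 2 M] [IsManifold J 2 N]
    (hV : MDiffAt (T% V) p.1) (hW : MDiffAt (T% W) p.2) :
    MDiffAt (T% (prodVectorField V W)) p :=
  (contMDiff_equivTangentBundleProd_symm (I := I) (M := M) (I' := J) (M' := N)
    (n := 1)).mdifferentiable one_ne_zero _ |>.comp p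
    ((hV.comp p mdifferentiableAt_fst).prodMk (hW.comp p mdifferentiableAt_snd))

lemma mfderiv_fst_prodVectorField :
    mfderiv% (Prod.fst : M × N → M) p (prodVectorField V W p) = V p.1 := by
  rw [mfderiv_fst]
  rfl

lemma mfderiv_snd_prodVectorField :
    mfderiv% (Prod.snd : M × N → N) p (prodVectorField V W p) = W p.2 := by
  rw [mfderiv_snd]
  rfl

lemma mlieBracket_prodVectorField [CompleteSpace E] [CompleteSpace E']
    [IsManifold I (minSmoothness 𝕜 2) M] [IsManifold J (minSmoothness 𝕜 2) N]
    (hV : MDiffAt (T% V) p.1) (hV' : MDiffAt (T% V') p.1)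
    (hW : MDiffAt (T% W) p.2) (hW' : MDiffAt (T% W') p.2) :
    mlieBracket (I.prod J) (prodVectorField V W) (prodVectorField V' W') p =
      prodVectorField (mlieBracket I V V') (mlieBracket J W W') p := by
  have hVW := mdifferentiableAt_prodVectorField hV hW
  have hVW' := mdifferentiableAt_prodVectorField hV' hW'
  have hfst := mfderiv_mlieBracket_of_related contMDiffAt_fst hVW hVW' hV hV'
    (.of_forall fun _ => mfderiv_fst_prodVectorField)
    (.of_forall fun _ => mfderiv_fst_prodVectorField)
  have hsnd := mfderiv_mlieBracket_of_related contMDiffAt_snd hVW hVW' hW hW'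
    (.of_forall fun _ => mfderiv_snd_prodVectorField)
    (.of_forall fun _ => mfderiv_snd_prodVectorField)
  rw [mfderiv_fst] at hfst
  rw [mfderiv_snd] at hsnd
  exact Prod.ext hfst hsnd

end LieBracket

section TangentGroup
open Bundle

variable {𝕜 : Type*} [NontriviallyNormedField 𝕜]
  {E : Type*} [NormedAddCommGroup E] [NormedSpace 𝕜 E] {H : Type*} [TopologicalSpace H]
  {I : ModelWithCorners 𝕜 E H} {G : Type*} [TopologicalSpace G] [ChartedSpace H G]
  {F : Type*} [NormedAddCommGroup F] [NormedSpace 𝕜 F] {K : Type*} [TopologicalSpace K]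
  {J : ModelWithCorners 𝕜 F K} {N : Type*} [TopologicalSpace N] [ChartedSpace K N] {n : ℕ∞ω}

/-- The multiplication of the tangent bundle `TG` that is the derivative of the multiplication
of `G`. -/
def tangentMul [Mul G] (ξ η : TangentBundle I G) : TangentBundle I G :=
  ⟨ξ.1 * η.1, mfderiv% (fun y : G => y * η.1) ξ.1 ξ.2 + mfderiv% (fun y : G => ξ.1 * y) η.1 η.2⟩

lemma contMDiff_tangentMul [Mul G] [IsManifold I 1 G] [ContMDiffMul I (n + 1) G]
    {ξ η : N → TangentBundle I G} (hξ : CMDiff n ξ) (hη : CMDiff n η) :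
    CMDiff n (fun y => tangentMul (ξ y) (η y)) := by
  have hmul := contMDiff_mul I (n + 1) (G := G)
  have hcomp := (hmul.contMDiff_tangentMap le_rfl).comp
    (contMDiff_equivTangentBundleProd_symm.comp (hξ.prodMk hη))
  convert! hcomp using 2 with y
  rw [Function.comp_apply, tangentMap, mfderiv_prod_eq_add_apply (hmul.mdifferentiableAt (by simp))]
  rfl

lemma tangentMul_zero_left [Mul G] (x : G) (η : TangentBundle I G) :
    tangentMul ⟨x, 0⟩ η = ⟨x * η.1, mfderiv% (fun y : G => x * y) η.1 η.2⟩ :=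
  congrArg (TotalSpace.mk _) <| by rw [map_zero]; exact zero_add _

lemma tangentMul_zero_right [Mul G] (ξ : TangentBundle I G) (x : G) :
    tangentMul ξ ⟨x, 0⟩ = ⟨ξ.1 * x, mfderiv% (fun y : G => y * x) ξ.1 ξ.2⟩ :=
  congrArg (TotalSpace.mk _) <| by rw [map_zero]; exact add_zero _

lemma tangentBundle_mk_eq_of_eq {x y : G} (h : x = y) (v : E) :
    (⟨x, v⟩ : TangentBundle I G) = ⟨y, v⟩ := by
  rw [h]

variable [Group G]

/-- The right invariant vector field with value `v` at `1`. -/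
def rightInvariantVectorField (v : GroupLieAlgebra I G) (g : G) : TangentSpace I g :=
  (mfderiv% (fun y : G => y * g) (1 : G) v : E)

/-- The left Maurer–Cartan form: it translates tangent vectors at `g` to `1`. -/
def maurerCartanForm (g : G) : TangentSpace I g →L[𝕜] GroupLieAlgebra I G :=
  (mfderiv% (fun y : G => g⁻¹ * y) g : E →L[𝕜] E)

lemma tangentMul_zero_one (g : G) (v : GroupLieAlgebra I G) :
    tangentMul ⟨g, 0⟩ ⟨1, v⟩ = ⟨g, mulInvariantVectorField v g⟩ :=
  (tangentMul_zero_left _ _).trans (tangentBundle_mk_eq_of_eq (mul_one g) _)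

lemma tangentMul_one_zero (v : GroupLieAlgebra I G) (g : G) :
    tangentMul ⟨1, v⟩ ⟨g, 0⟩ = ⟨g, rightInvariantVectorField v g⟩ :=
  (tangentMul_zero_right _ _).trans (tangentBundle_mk_eq_of_eq (one_mul g) _)

lemma tangentMul_inv_zero (g : G) (v : TangentSpace I g) :
    tangentMul ⟨g⁻¹, 0⟩ ⟨g, v⟩ = ⟨1, maurerCartanForm g v⟩ :=
  (tangentMul_zero_left _ _).trans (tangentBundle_mk_eq_of_eq (inv_mul_cancel g) _)

lemma mfderiv_one_of_eq_id {f : G → G} (hf : f = id) (v : GroupLieAlgebra I G) :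
    (mfderiv% f (1 : G) v : E) = v := by
  subst hf
  exact congr($mfderiv_id v)

lemma rightInvariantVectorField_one (v : GroupLieAlgebra I G) :
    rightInvariantVectorField v (1 : G) = v :=
  mfderiv_one_of_eq_id (funext mul_one) v

lemma mulInvariantVectorField_one (v : GroupLieAlgebra I G) :
    mulInvariantVectorField v (1 : G) = v :=
  mfderiv_one_of_eq_id (funext one_mul) v

/-- `mulInvariantVectorField` as a linear map, which makes the `map_*` lemmas available for it. -/
def mulInvariantVectorFieldₗ : GroupLieAlgebra I G →ₗ[𝕜] ∀ g : G, TangentSpace I g where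
  toFun := mulInvariantVectorField
  map_add' := mulInvariantVectorField_add
  map_smul' := mulInvariantVectorField_smul

lemma mulInvariantVectorFieldₗ_apply (v : GroupLieAlgebra I G) :
    mulInvariantVectorFieldₗ v = (mulInvariantVectorField v : ∀ g : G, TangentSpace I g) :=
  rfl

variable (I) in
lemma t2Space_of_lieGroup (n : ℕ∞ω) [LieGroup I n G] : T2Space G :=
  have := I.t1Space G
  have := topologicalGroup_of_lieGroup I n (G := G)
  inferInstance

section Smooth

variable [IsManifold I 1 G] [LieGroup I (n + 1) G]

lemma contMDiff_mulInvariantVectorField_of_lieGroup (v : GroupLieAlgebra I G) :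
    CMDiff n (T% (mulInvariantVectorField v : ∀ g : G, TangentSpace I g)) := by
  simp_rw [← tangentMul_zero_one]
  exact contMDiff_tangentMul (contMDiff_zeroSection 𝕜 _) contMDiff_const

lemma contMDiff_rightInvariantVectorField (v : GroupLieAlgebra I G) :
    CMDiff n (T% (rightInvariantVectorField v : ∀ g : G, TangentSpace I g)) := by
  simp_rw [← tangentMul_one_zero]
  exact contMDiff_tangentMul contMDiff_const (contMDiff_zeroSection 𝕜 _)

lemma contMDiff_maurerCartanForm {X : ∀ g : G, TangentSpace I g} (hX : CMDiff n (T% X)) :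
    ContMDiff I 𝓘(𝕜, E) n (M' := E) (fun g => maurerCartanForm g (X g)) := by
  have hTG : CMDiff n (fun g => (⟨1, maurerCartanForm g (X g)⟩ : TangentBundle I G)) := by
    simp_rw [← tangentMul_inv_zero]
    exact contMDiff_tangentMul
      ((contMDiff_zeroSection 𝕜 _).comp ((contMDiff_inv I (n + 1)).of_le le_self_add)) hX
  intro g
  refine (contMDiffAt_totalSpace.1 (hTG g)).2.congr_of_eventuallyEq (.of_forall fun y => ?_)
  exact ((tangentBundleCore I G).coordChange_self (achart H 1) 1 (mem_achart_source H 1) _).symm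

end Smooth

section Bracket

variable [LieGroup I (minSmoothness 𝕜 3) G]

lemma mdifferentiableAt_mul_left (g h : G) : MDiffAt (fun y : G => g * y) h :=
  contMDiff_mul_left.mdifferentiableAt (n := minSmoothness 𝕜 3)
    (three_pos.trans_le le_minSmoothness).ne'

lemma mdifferentiableAt_mul_right (g h : G) : MDiffAt (fun y : G => y * g) h :=
  contMDiff_mul_right.mdifferentiableAt (n := minSmoothness 𝕜 3)
    (three_pos.trans_le le_minSmoothness).ne'

lemma mulInvariantVectorField_maurerCartanForm (g : G) (v : TangentSpace I g) :
    mulInvariantVectorField (maurerCartanForm g v) g = v := by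
  have hid : (fun y : G => g * y) ∘ (fun y => g⁻¹ * y) = id := funext (mul_inv_cancel_left g)
  have hchain := mfderiv_comp g (mdifferentiableAt_mul_left g (g⁻¹ * g))
    (mdifferentiableAt_mul_left (I := I) g⁻¹ g)
  rw [hid, mfderiv_id] at hchain
  refine Eq.trans ?_ congr($hchain v).symm
  rw [mulInvariantVectorField, ← inv_mul_cancel g]
  rfl

lemma eq_sum_smul_mulInvariantVectorField {ι : Type*} [Fintype ι]
    (b : Module.Basis ι 𝕜 (GroupLieAlgebra I G)) (W : ∀ g : G, TangentSpace I g) :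
    W = ∑ i, (fun g => b.coord i (maurerCartanForm g (W g)) : G → 𝕜) •
      mulInvariantVectorField (b i) := by
  ext g
  have hrepr := congrArg (mulInvariantVectorFieldₗ · g) (b.sum_repr (maurerCartanForm g (W g)))
  simp only [map_sum, map_smul, mulInvariantVectorFieldₗ_apply,
    mulInvariantVectorField_maurerCartanForm] at hrepr
  rw [← hrepr, Finset.sum_apply, Finset.sum_apply]
  rfl

lemma mfderiv_mul_left_mulInvariantVectorField (v : GroupLieAlgebra I G) (g h : G) :
    mfderiv% (fun y : G => g * y) h (mulInvariantVectorField v h) =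
      mulInvariantVectorField v (g * h) := by
  have hcomp : (fun y : G => g * h * y) = (fun y => g * y) ∘ (fun y => h * y) :=
    funext (mul_assoc g h)
  have hchain := mfderiv_comp (1 : G) (mdifferentiableAt_mul_left g (h * 1))
    (mdifferentiableAt_mul_left (I := I) h 1)
  rw [mulInvariantVectorField, mulInvariantVectorField, hcomp, hchain, mul_one]
  rfl

lemma mfderiv_mul_right_rightInvariantVectorField (v : GroupLieAlgebra I G) (g h : G) :
    mfderiv% (fun y : G => y * h) g (rightInvariantVectorField v g) =
      rightInvariantVectorField v (g * h) := by
  have hcomp : (fun y : G => y * (g * h)) = (fun y => y * h) ∘ (fun y => y * g) :=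
    funext fun y => (mul_assoc y g h).symm
  have hchain := mfderiv_comp (1 : G) (mdifferentiableAt_mul_right h (1 * g))
    (mdifferentiableAt_mul_right (I := I) g 1)
  rw [rightInvariantVectorField, rightInvariantVectorField, hcomp, hchain, one_mul]
  rfl

open VectorField

lemma mfderiv_mul_prodVectorField (V W : ∀ g : G, TangentSpace I g) (p : G × G) :
    mfderiv% (fun q : G × G => q.1 * q.2) p (prodVectorField V W p) =
      mfderiv% (fun y : G => y * p.2) p.1 (V p.1) + mfderiv% (fun y : G => p.1 * y) p.2 (W p.2) :=
  mfderiv_prod_eq_add_apply ((contMDiff_mul I (minSmoothness 𝕜 3)).mdifferentiableAt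
    (three_pos.trans_le le_minSmoothness).ne')

lemma mfderiv_mul_rightInvariantVectorField_zero (v : GroupLieAlgebra I G) (p : G × G) :
    mfderiv% (fun q : G × G => q.1 * q.2) p (prodVectorField (rightInvariantVectorField v) 0 p) =
      rightInvariantVectorField v (p.1 * p.2) := by
  rw [mfderiv_mul_prodVectorField, mfderiv_mul_right_rightInvariantVectorField, Pi.zero_apply,
    map_zero]
  exact add_zero _

lemma mfderiv_mul_zero_mulInvariantVectorField (w : GroupLieAlgebra I G) (p : G × G) :
    mfderiv% (fun q : G × G => q.1 * q.2) p (prodVectorField 0 (mulInvariantVectorField w) p) =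
      mulInvariantVectorField w (p.1 * p.2) := by
  rw [mfderiv_mul_prodVectorField, mfderiv_mul_left_mulInvariantVectorField, Pi.zero_apply,
    map_zero]
  exact zero_add _

lemma mdifferentiableAt_rightInvariantVectorField (v : GroupLieAlgebra I G) (g : G) :
    MDiffAt (T% (rightInvariantVectorField v : ∀ g : G, TangentSpace I g)) g :=
  have : LieGroup I (1 + 1) G :=
    .of_le (n := minSmoothness 𝕜 3) (le_trans (by norm_num) le_minSmoothness)
  contMDiff_rightInvariantVectorField v |>.mdifferentiableAt one_ne_zero

lemma mlieBracket_rightInvariantVectorField_mulInvariantVectorField [CompleteSpace E]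
    (v w : GroupLieAlgebra I G) :
    mlieBracket I (rightInvariantVectorField v : ∀ g : G, TangentSpace I g)
      (mulInvariantVectorField w) = 0 := by
  have : IsManifold I 2 G :=
    .of_le (n := minSmoothness 𝕜 3) (le_trans (by norm_num) le_minSmoothness)
  have : IsManifold I (minSmoothness 𝕜 2) G :=
    .of_le (n := minSmoothness 𝕜 3) (minSmoothness_monotone (by norm_num))
  have hR := mdifferentiableAt_rightInvariantVectorField (G := G) v
  have hL (h : G) := mdifferentiableAt_mulInvariantVectorField (g := h) w
  have hzero (h : G) : MDiffAt (T% (0 : ∀ g : G, TangentSpace I g)) h :=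
    Bundle.mdifferentiableAt_zeroSection ..
  have hbracket (p : G × G) : mlieBracket I (rightInvariantVectorField v)
      (mulInvariantVectorField w) (p.1 * p.2) = 0 := by
    rw [← mfderiv_mlieBracket_of_related (x := p)
      ((contMDiff_mul I (minSmoothness 𝕜 3)).of_le (minSmoothness_monotone (by norm_num)) _)
      (mdifferentiableAt_prodVectorField (hR _) (hzero _))
      (mdifferentiableAt_prodVectorField (hzero _) (hL _)) (hR _) (hL _)
      (.of_forall (mfderiv_mul_rightInvariantVectorField_zero v))
      (.of_forall (mfderiv_mul_zero_mulInvariantVectorField w)),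
      mlieBracket_prodVectorField (hR _) (hzero _) (hzero _) (hL _), mlieBracket_zero_left,
      mlieBracket_zero_right]
    exact map_zero _
  ext g
  exact mul_one g ▸ hbracket (g, 1)

end Bracket

end TangentGroup

section Connection
open Set Filter Topology

variable {E : Type*} [NormedAddCommGroup E] [NormedSpace ℝ E]
  {M : Type*} [TopologicalSpace M] [ChartedSpace E M] [IsManifold 𝓘(ℝ, E) ∞ M]
  {D : Connection E M} {S W W' X Y Y' Z Z' : VField E M} {c : M → ℝ} {U : Set M} {x : M}

lemma smoothOn_univ : SmoothOn X univ ↔ CMDiff ∞ (T% X) :=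
  contMDiffOn_univ

lemma SmoothOn.mdifferentiableAt (hX : SmoothOn X univ) : MDiffAt (T% X) x :=
  (smoothOn_univ.1 hX).mdifferentiableAt (by simp)

lemma exists_smoothOn_univ_eventuallyEq [FiniteDimensional ℝ E] [T2Space M] (hX : SmoothOn X U)
    (hU : IsOpen U) (hx : x ∈ U) : ∃ X' : VField E M, SmoothOn X' univ ∧ X' =ᶠ[𝓝 x] X := by
  obtain ⟨ψ, -, hψU⟩ := (SmoothBumpFunction.nhds_basis_tsupport (I := 𝓘(ℝ, E)) x).mem_iff.1
    (hU.mem_nhds hx)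
  refine ⟨⇑ψ • X, smoothOn_univ.2 <|
    ContMDiffOn.smul_section_of_tsupport ψ.contMDiff.contMDiffOn hU hψU hX, ?_⟩
  filter_upwards [ψ.eventuallyEq_one] with y hy
  exact (congrArg (· • X y) hy).trans (one_smul ℝ (X y))

lemma mdifferentiableAt_nabla (hD : D.ContMDiffCovariantDerivative ∞)
    (hX : MDiffAt (T% X) x) (hY : SmoothOn Y univ) : MDiffAt (T% (nabla D X Y)) x :=
  ((hD.contMDiff.contMDiff (by simpa [SmoothOn] using hY)).contMDiffAt
    univ_mem).mdifferentiableAt (by simp) |>.clm_bundle_apply hX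

lemma nabla_smul (hc : MDiffAt c x) (hS : MDiffAt (T% S) x) :
    nabla D X (c • S) x = c x • nabla D X S x + d% c x (X x) • S x := by
  simp [nabla, D.isCovariantDerivativeOnUniv.leibniz hS hc]

lemma nabla_add (hS : MDiffAt (T% S) x) (hW : MDiffAt (T% W) x) :
    nabla D X (S + W) x = nabla D X S x + nabla D X W x := by
  simp [nabla, D.isCovariantDerivativeOnUniv.add hS hW]

lemma nabla_zero : nabla D X 0 = 0 := by
  ext x
  simp [nabla]

lemma zero_nabla : nabla D 0 X = 0 := by
  ext x
  simp [nabla]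

lemma nabla_congr (hW' : MDiffAt (T% W') x) (h : W =ᶠ[𝓝 x] W') :
    nabla D X W x = nabla D X W' x := by
  have hW : MDiffAt (T% W) x := hW'.congr_of_eventuallyEq (h.mono fun y hy => by simp [hy])
  exact congr($(D.isCovariantDerivativeOnUniv.congr_of_eventuallyEq hW hW' univ_mem h) (X x))

lemma tensorialAt_nablaSq (hD : D.ContMDiffCovariantDerivative ∞)
    (hW : SmoothOn W univ) (x : M) :
    TensorialAt 𝓘(ℝ, E) E (fun Z => nablaSq D W Y Z x) x where
  smul {f σ} hf hσ := by
    have hsmul : nabla D (f • σ) W = f • nabla D σ W := by ext y; simp [nabla]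
    have houter := nabla_smul (D := D) (X := Y) hf (mdifferentiableAt_nabla hD hσ hW)
    have hinner := nabla_smul (D := D) (X := Y) hf hσ
    simp only [nablaSq, Pi.sub_apply, hsmul, houter]
    simp only [nabla] at hinner ⊢
    rw [hinner]
    simp only [map_add, map_smul]
    module
  add {σ τ} hσ hτ := by
    have hadd : nabla D (σ + τ) W = nabla D σ W + nabla D τ W := by ext y; simp [nabla]
    have houter := nabla_add (D := D) (X := Y) (mdifferentiableAt_nabla hD hσ hW)
      (mdifferentiableAt_nabla hD hτ hW)
    have hinner := nabla_add (D := D) (X := Y) hσ hτ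
    simp only [nablaSq, Pi.sub_apply, hadd, houter]
    simp only [nabla] at hinner ⊢
    rw [hinner]
    simp only [map_add]
    module

lemma nablaSq_congr [FiniteDimensional ℝ E]
    (hD : D.ContMDiffCovariantDerivative ∞) (hW : SmoothOn W univ)
    (hZ : MDiffAt (T% Z) x) (hZ' : MDiffAt (T% Z') x) (hYY' : Y x = Y' x) (hZZ' : Z x = Z' x) :
    nablaSq D W Y Z x = nablaSq D W Y' Z' x := by
  rw [← (tensorialAt_nablaSq hD hW x).pointwise hZ hZ' hZZ']
  simp [nablaSq, nabla, hYY']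

lemma curvature_eq_nablaSq_sub_add_torsion [FiniteDimensional ℝ E]
    (hY : MDiffAt (T% Y) x) (hZ : MDiffAt (T% Z) x) :
    curvature D Y Z W x =
      nablaSq D W Y Z x - nablaSq D W Z Y x + D W x (D.torsion x (Y x) (Z x)) := by
  rw [D.torsion_apply hY hZ]
  simp only [curvature, nablaSq, Pi.sub_apply, nabla, map_sub]
  abel

lemma curvature_eq_nablaSq_sub [FiniteDimensional ℝ E] (hT : D.torsion = 0)
    (hY : MDiffAt (T% Y) x) (hZ : MDiffAt (T% Z) x) :
    curvature D Y Z W x = nablaSq D W Y Z x - nablaSq D W Z Y x := by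
  simp [curvature_eq_nablaSq_sub_add_torsion hY hZ, hT]

lemma curvature_congr_left_of_apply_eq [FiniteDimensional ℝ E]
    (hD : D.ContMDiffCovariantDerivative ∞)
    (hY : MDiffAt (T% Y) x) (hZ : MDiffAt (T% Z) x)
    (hY' : MDiffAt (T% Y') x) (hZ' : MDiffAt (T% Z') x) (hW : SmoothOn W univ)
    (hYY' : Y x = Y' x) (hZZ' : Z x = Z' x) :
    curvature D Y Z W x = curvature D Y' Z' W x := by
  rw [curvature_eq_nablaSq_sub_add_torsion hY hZ, curvature_eq_nablaSq_sub_add_torsion hY' hZ',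
    nablaSq_congr hD hW hZ hZ' hYY' hZZ', nablaSq_congr hD hW hY hY' hZZ' hYY', hYY', hZZ']

lemma curvature_congr_right_of_eventuallyEq
    (hD : D.ContMDiffCovariantDerivative ∞)
    (hY : MDiffAt (T% Y) x) (hZ : MDiffAt (T% Z) x) (hW' : SmoothOn W' univ) (h : W =ᶠ[𝓝 x] W') :
    curvature D Y Z W x = curvature D Y Z W' x := by
  have hnabla (V : VField E M) : nabla D V W =ᶠ[𝓝 x] nabla D V W' :=
    h.eventually_nhds.mono fun y hy => nabla_congr hW'.mdifferentiableAt hy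
  simp only [curvature, Pi.sub_apply]
  rw [nabla_congr (mdifferentiableAt_nabla hD hZ hW') (hnabla Z),
    nabla_congr (mdifferentiableAt_nabla hD hY hW') (hnabla Y), (hnabla _).self_of_nhds]

lemma curvature_zero : curvature D Y Z 0 = 0 := by
  simp [curvature, nabla_zero]

lemma curvature_add (hD : D.ContMDiffCovariantDerivative ∞)
    (hY : MDiffAt (T% Y) x) (hZ : MDiffAt (T% Z) x) (hS : SmoothOn S univ)
    (hW : SmoothOn W univ) :
    curvature D Y Z (S + W) x = curvature D Y Z S x + curvature D Y Z W x := by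
  have hadd (V : VField E M) : nabla D V (S + W) = nabla D V S + nabla D V W :=
    funext fun _ => nabla_add hS.mdifferentiableAt hW.mdifferentiableAt
  simp only [curvature, Pi.sub_apply, hadd, Pi.add_apply]
  rw [nabla_add (mdifferentiableAt_nabla hD hZ hS) (mdifferentiableAt_nabla hD hZ hW),
    nabla_add (mdifferentiableAt_nabla hD hY hS) (mdifferentiableAt_nabla hD hY hW)]
  abel

lemma nabla_nabla_smul [CompleteSpace E]
    (hD : D.ContMDiffCovariantDerivative ∞)
    (hc : CMDiff ∞ c) (hZ : MDiffAt (T% Z) x) (hS : SmoothOn S univ) :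
    nabla D Y (nabla D Z (c • S)) x =
      c x • nabla D Y (nabla D Z S) x + d% c x (Y x) • nabla D Z S x +
        (d% c x (Z x) • nabla D Y S x + d% (fun y => d% c y (Z y)) x (Y x) • S x) := by
  have hc' (y : M) : MDiffAt c y := hc.mdifferentiableAt (by simp)
  have hZS := mdifferentiableAt_nabla hD hZ hS
  have hdc := mdifferentiableAt_mvfderiv_apply hc.contMDiffAt
    (show (2 : ℕ∞ω) ≤ ∞ from WithTop.coe_le_coe.2 le_top) hZ
  have hfun : nabla D Z (c • S) = c • nabla D Z S + (fun y => d% c y (Z y)) • S :=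
    funext fun y => nabla_smul (hc' y) hS.mdifferentiableAt
  rw [hfun, nabla_add ((hc' x).smul_section hZS) (hdc.smul_section hS.mdifferentiableAt),
    nabla_smul (hc' x) hZS, nabla_smul hdc hS.mdifferentiableAt]

lemma curvature_smul [CompleteSpace E] (hD : D.ContMDiffCovariantDerivative ∞)
    (hc : CMDiff ∞ c) (hY : MDiffAt (T% Y) x) (hZ : MDiffAt (T% Z) x) (hS : SmoothOn S univ) :
    curvature D Y Z (c • S) x = c x • curvature D Y Z S x := by
  have hn : minSmoothness ℝ 2 ≤ ∞ := by
    rw [minSmoothness_of_isRCLikeNormedField]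
    exact WithTop.coe_le_coe.2 le_top
  simp only [curvature, Pi.sub_apply]
  rw [nabla_nabla_smul hD hc hZ hS, nabla_nabla_smul hD hc hY hS,
    nabla_smul (hc.mdifferentiableAt (by simp)) hS.mdifferentiableAt,
    mvfderiv_apply_mlieBracket hc.contMDiffAt hn hY hZ]
  module

lemma curvature_sum_smul [CompleteSpace E]
    (hD : D.ContMDiffCovariantDerivative ∞) {ι : Type*} (s : Finset ι)
    {c : ι → M → ℝ} {S : ι → VField E M} (hc : ∀ i, CMDiff ∞ (c i)) (hY : MDiffAt (T% Y) x)
    (hZ : MDiffAt (T% Z) x) (hS : ∀ i, SmoothOn (S i) univ) :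
    curvature D Y Z (∑ i ∈ s, c i • S i) x = ∑ i ∈ s, c i x • curvature D Y Z (S i) x := by
  have hcS (i : ι) : CMDiff ∞ (T% (c i • S i)) := (hc i).smul_section (smoothOn_univ.1 (hS i))
  have hsum (s : Finset ι) : SmoothOn (∑ i ∈ s, c i • S i) univ := by
    convert! smoothOn_univ.2 (ContMDiff.sum_section fun i (_ : i ∈ s) => hcS i)
    exact Finset.sum_apply ..
  induction s using Finset.cons_induction with
  | empty => simp [curvature_zero]
  | cons i s his ih =>
    rw [Finset.sum_cons, Finset.sum_cons,
      curvature_add hD hY hZ (smoothOn_univ.2 (hcS i)) (hsum s), ih,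
      curvature_smul hD (hc i) hY hZ (hS i)]

end Connection

section LieGroup
open Set VectorField

variable {E : Type*} [NormedAddCommGroup E] [NormedSpace ℝ E]
  {G : Type*} [TopologicalSpace G] [ChartedSpace E G] [Group G] [LieGroup 𝓘(ℝ, E) ∞ G]
  {D : Connection E G} {V W X Y Z : VField E G} {g : G}

instance lieGroup_minSmoothness : LieGroup 𝓘(ℝ, E) (minSmoothness ℝ 3) G :=
  .of_le (n := ∞) <| by
    rw [minSmoothness_of_isRCLikeNormedField]
    exact WithTop.coe_le_coe.2 le_top

lemma smoothOn_mulInvariantVectorField (v : GroupLieAlgebra 𝓘(ℝ, E) G) :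
    SmoothOn (mulInvariantVectorField v : VField E G) univ :=
  have : LieGroup 𝓘(ℝ, E) (∞ + 1) G := ‹_›
  smoothOn_univ.2 (contMDiff_mulInvariantVectorField_of_lieGroup v)

lemma smoothOn_rightInvariantVectorField (v : GroupLieAlgebra 𝓘(ℝ, E) G) :
    SmoothOn (rightInvariantVectorField v : VField E G) univ :=
  have : LieGroup 𝓘(ℝ, E) (∞ + 1) G := ‹_›
  smoothOn_univ.2 (contMDiff_rightInvariantVectorField v)

lemma exists_linearMap_curvature_eq [FiniteDimensional ℝ E] (hD : D.ContMDiffCovariantDerivative ∞)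
    (hY : MDiffAt (T% Y) g) (hZ : MDiffAt (T% Z) g) :
    ∃ φ : TangentSpace 𝓘(ℝ, E) g →ₗ[ℝ] TangentSpace 𝓘(ℝ, E) g,
      ∀ W : VField E G, SmoothOn W univ → curvature D Y Z W g = φ (W g) := by
  have : CompleteSpace E := FiniteDimensional.complete ℝ E
  have : LieGroup 𝓘(ℝ, E) (∞ + 1) G := ‹_›
  let b : Module.Basis _ ℝ (GroupLieAlgebra 𝓘(ℝ, E) G) := Module.finBasis ℝ E
  refine ⟨b.constr ℝ (fun i => curvature D Y Z (mulInvariantVectorField (b i)) g) ∘ₗ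
    (maurerCartanForm g).toLinearMap, fun W hW => ?_⟩
  have hcoord (i) : CMDiff ∞ (fun y => b.coord i (maurerCartanForm y (W y))) :=
    (LinearMap.toContinuousLinearMap (show E →ₗ[ℝ] ℝ from b.coord i)).contMDiff.comp
      (contMDiff_maurerCartanForm (smoothOn_univ.1 hW))
  conv_lhs => rw [eq_sum_smul_mulInvariantVectorField b W]
  rw [curvature_sum_smul hD _ hcoord hY hZ fun i => smoothOn_mulInvariantVectorField (b i)]
  simp [Module.Basis.constr_apply_fintype]

lemma exists_linearMap_curvature_eq_of_smoothOn [FiniteDimensional ℝ E]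
    (hD : D.ContMDiffCovariantDerivative ∞) (hY : MDiffAt (T% Y) g) (hZ : MDiffAt (T% Z) g) :
    ∃ φ : TangentSpace 𝓘(ℝ, E) g →ₗ[ℝ] TangentSpace 𝓘(ℝ, E) g, ∀ (U : Set G) (W : VField E G),
      IsOpen U → g ∈ U → SmoothOn W U → curvature D Y Z W g = φ (W g) := by
  have : T2Space G := t2Space_of_lieGroup 𝓘(ℝ, E) ∞
  obtain ⟨φ, hφ⟩ := exists_linearMap_curvature_eq hD hY hZ
  refine ⟨φ, fun U W hU hg hW => ?_⟩
  obtain ⟨W', hW', hWW'⟩ := exists_smoothOn_univ_eventuallyEq hW hU hg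
  rw [curvature_congr_right_of_eventuallyEq hD hY hZ hW' hWW'.symm, hφ W' hW', hWW'.self_of_nhds]

/-- Left invariance of a vector field, encoded as being the left translate of its value at `1`. -/
def IsLeftInvariantField (V : VField E G) : Prop :=
  V = mulInvariantVectorField (V 1)

omit [LieGroup 𝓘(ℝ, E) ∞ G] in
lemma isLeftInvariantField_mulInvariantVectorField (v : GroupLieAlgebra 𝓘(ℝ, E) G) :
    IsLeftInvariantField (mulInvariantVectorField v : VField E G) := by
  rw [IsLeftInvariantField, mulInvariantVectorField_one]

namespace IsLeftInvariantField

lemma smoothOn (hV : IsLeftInvariantField V) : SmoothOn V univ := by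
  rw [hV]
  exact smoothOn_mulInvariantVectorField _

omit [LieGroup 𝓘(ℝ, E) ∞ G] in
lemma eq_zero (hV : IsLeftInvariantField V) (h : V 1 = 0) : V = 0 := by
  rw [hV, h]
  exact map_zero mulInvariantVectorFieldₗ

omit [LieGroup 𝓘(ℝ, E) ∞ G] in
lemma sub (hV : IsLeftInvariantField V) (hW : IsLeftInvariantField W) :
    IsLeftInvariantField (V - W) := by
  calc
    V - W = mulInvariantVectorFieldₗ (V 1) - mulInvariantVectorFieldₗ (W 1) := congrArg₂ _ hV hW
    _ = mulInvariantVectorFieldₗ (V 1 - W 1) := (map_sub ..).symm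

lemma mlieBracket [CompleteSpace E] (hV : IsLeftInvariantField V) (hW : IsLeftInvariantField W) :
    IsLeftInvariantField (VectorField.mlieBracket 𝓘(ℝ, E) V W) := by
  rw [hV, hW]
  exact (mulInvariantVector_mlieBracket _ _).symm

lemma mpullback_mul_left (hV : IsLeftInvariantField V) (g : G) :
    mpullback 𝓘(ℝ, E) 𝓘(ℝ, E) (fun x => g * x) V = V := by
  rw [hV, mpullback_mulInvariantVectorField]

lemma of_mpullback_mul_left_eq
    (hV : ∀ g : G, mpullback 𝓘(ℝ, E) 𝓘(ℝ, E) (fun x => g * x) V = V) : IsLeftInvariantField V := by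
  ext g
  rw [mulInvariantVectorField_eq_mpullback g V, hV]

lemma nabla (hD : IsLeftInvariant D) (hV : IsLeftInvariantField V) (hW : IsLeftInvariantField W) :
    IsLeftInvariantField (nabla D V W) :=
  .of_mpullback_mul_left_eq fun g => by
    rw [hD g _ _ hV.smoothOn hW.smoothOn, hV.mpullback_mul_left, hW.mpullback_mul_left]

lemma curvature [CompleteSpace E] (hD : IsLeftInvariant D) (hV : IsLeftInvariantField V)
    (hW : IsLeftInvariantField W) (hX : IsLeftInvariantField X) :
    IsLeftInvariantField (curvature D V W X) :=
  ((hV.nabla hD (hW.nabla hD hX)).sub (hW.nabla hD (hV.nabla hD hX))).sub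
    ((hV.mlieBracket hW).nabla hD hX)

end IsLeftInvariantField

lemma exists_isLeftInvariantField_apply_eq (V : VField E G) (g : G) :
    ∃ V' : VField E G, IsLeftInvariantField V' ∧ V' g = V g :=
  ⟨_, isLeftInvariantField_mulInvariantVectorField _,
    mulInvariantVectorField_maurerCartanForm g (V g)⟩

omit [LieGroup 𝓘(ℝ, E) ∞ G] in
lemma solutionSpan_le_localSolutionSpan [IsManifold 𝓘(ℝ, E) 1 G] {D : Connection E G} :
    solutionSpan D ≤ localSolutionSpan D :=
  Submodule.span_mono fun _ ⟨X, hX, hw⟩ => ⟨univ, X, isOpen_univ, mem_univ 1, hX, hw⟩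

lemma nabla_rightInvariantVectorField [FiniteDimensional ℝ E] (hT : D.torsion = 0)
    (hV : IsLeftInvariantField V) (v : GroupLieAlgebra 𝓘(ℝ, E) G) :
    nabla D V (rightInvariantVectorField v) = nabla D (rightInvariantVectorField v) V := by
  have : CompleteSpace E := FiniteDimensional.complete ℝ E
  ext g
  have h := D.torsion_eq_zero_iff.1 hT
    (smoothOn_rightInvariantVectorField (G := G) v).mdifferentiableAt
    (hV.smoothOn.mdifferentiableAt (x := g))
  rw [hV, mlieBracket_rightInvariantVectorField_mulInvariantVectorField, ← hV, Pi.zero_apply,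
    sub_eq_zero] at h
  exact h.symm

lemma nablaSq_rightInvariantVectorField [FiniteDimensional ℝ E] (hT : D.torsion = 0)
    (hD : IsLeftInvariant D) (hV : IsLeftInvariantField V) (hW : IsLeftInvariantField W)
    (v : GroupLieAlgebra 𝓘(ℝ, E) G) :
    nablaSq D (rightInvariantVectorField v) V W =
      -curvature D (rightInvariantVectorField v) V W := by
  have : CompleteSpace E := FiniteDimensional.complete ℝ E
  have hbracket : mlieBracket 𝓘(ℝ, E) (rightInvariantVectorField v) V = 0 := by
    rw [hV, mlieBracket_rightInvariantVectorField_mulInvariantVectorField]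
  rw [nablaSq, curvature, hbracket, zero_nabla, sub_zero, neg_sub,
    nabla_rightInvariantVectorField hT hW, nabla_rightInvariantVectorField hT (hV.nabla hD hW)]

variable [FiniteDimensional ℝ E]

lemma curvature_apply_one_eq_zero (hD : IsSLC D) (hspan : localSolutionSpan D = ⊤)
    (hY : SmoothOn Y univ) (hZ : SmoothOn Z univ) (hW : SmoothOn W univ) :
    curvature D Y Z W 1 = 0 := by
  obtain ⟨φ, hφ⟩ := exists_linearMap_curvature_eq_of_smoothOn hD.smooth
    (hY.mdifferentiableAt (x := 1)) hZ.mdifferentiableAt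
  have hker : localSolutionSpan D ≤ LinearMap.ker φ := by
    refine Submodule.span_le.2 ?_
    rintro _ ⟨U, X, hU, h1, ⟨hX, hXsol⟩, rfl⟩
    rw [SetLike.mem_coe, LinearMap.mem_ker, ← hφ U X hU h1 hX,
      curvature_eq_nablaSq_sub hD.torsionFree hY.mdifferentiableAt hZ.mdifferentiableAt,
      hXsol Y Z hY hZ 1 h1, hXsol Z Y hZ hY 1 h1, sub_zero]
  rw [hφ univ W isOpen_univ (mem_univ 1) hW]
  exact hker (hspan ▸ Submodule.mem_top)

lemma isFlat_of_localSolutionSpan_eq_top (hD : IsSLC D) (hspan : localSolutionSpan D = ⊤) :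
    IsFlat D := by
  have : CompleteSpace E := FiniteDimensional.complete ℝ E
  intro Y Z W hY hZ hW
  ext g
  obtain ⟨Y', hY', hYY'⟩ := exists_isLeftInvariantField_apply_eq Y g
  obtain ⟨Z', hZ', hZZ'⟩ := exists_isLeftInvariantField_apply_eq Z g
  obtain ⟨W', hW', hWW'⟩ := exists_isLeftInvariantField_apply_eq W g
  obtain ⟨φ, hφ⟩ := exists_linearMap_curvature_eq hD.smooth
    (hY'.smoothOn.mdifferentiableAt (x := g)) hZ'.smoothOn.mdifferentiableAt
  have hone := curvature_apply_one_eq_zero hD hspan hY'.smoothOn hZ'.smoothOn hW'.smoothOn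
  rw [curvature_congr_left_of_apply_eq hD.smooth hY.mdifferentiableAt hZ.mdifferentiableAt
      hY'.smoothOn.mdifferentiableAt hZ'.smoothOn.mdifferentiableAt hW hYY'.symm hZZ'.symm,
    hφ W hW, ← hWW', ← hφ W' hW'.smoothOn,
    (hY'.curvature hD.leftInvariant hZ' hW').eq_zero hone]

lemma isSolutionOn_rightInvariantVectorField (hD : IsSLC D) (hflat : IsFlat D)
    (v : GroupLieAlgebra 𝓘(ℝ, E) G) :
    IsSolutionOn D (rightInvariantVectorField v) univ := by
  have hR := smoothOn_rightInvariantVectorField (G := G) v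
  refine ⟨hR, fun Y Z _ hZ g _ => ?_⟩
  obtain ⟨Y', hY', hYY'⟩ := exists_isLeftInvariantField_apply_eq Y g
  obtain ⟨Z', hZ', hZZ'⟩ := exists_isLeftInvariantField_apply_eq Z g
  rw [nablaSq_congr hD.smooth hR hZ.mdifferentiableAt hZ'.smoothOn.mdifferentiableAt
      hYY'.symm hZZ'.symm,
    nablaSq_rightInvariantVectorField hD.torsionFree hD.leftInvariant hY' hZ',
    hflat _ Y' Z' hR hY'.smoothOn hZ'.smoothOn, neg_zero, Pi.zero_apply]

lemma solutionSpan_eq_top_of_isFlat (hD : IsSLC D) (hflat : IsFlat D) : solutionSpan D = ⊤ :=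
  eq_top_iff.2 fun v _ => Submodule.subset_span
    ⟨_, isSolutionOn_rightInvariantVectorField hD hflat v, rightInvariantVectorField_one v⟩

omit [LieGroup 𝓘(ℝ, E) ∞ G] in
lemma finrank_sub_eq_zero_iff (S : Submodule ℝ (TangentSpace 𝓘(ℝ, E) (1 : G))) :
    ((Module.finrank ℝ E - Module.finrank ℝ S : ℕ) : ℕ∞) = 0 ↔ S = ⊤ := by
  have : FiniteDimensional ℝ (TangentSpace 𝓘(ℝ, E) (1 : G)) := ‹FiniteDimensional ℝ E›
  have h : Module.finrank ℝ (TangentSpace 𝓘(ℝ, E) (1 : G)) = Module.finrank ℝ E := rfl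
  rw [Nat.cast_eq_zero, ← h, Nat.sub_eq_zero_iff_le]
  exact ⟨fun hle => Submodule.eq_top_of_finrank_eq (le_antisymm S.finrank_le hle),
    fun hS => by rw [hS, finrank_top]⟩

end LieGroup

end LeftInvariantGauge

end

theorem mainTheorem10
    {E : Type*} [NormedAddCommGroup E] [NormedSpace ℝ E] [FiniteDimensional ℝ E]
    {G : Type*} [TopologicalSpace G] [ChartedSpace E G] [Group G]
    [LieGroup 𝓘(ℝ, E) ∞ G] :
    (LeftInvariantGauge.rb E G = 0 ↔
      LeftInvariantGauge.AdmitsLeftInvariantLocallyFlat E G) ∧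
    (LeftInvariantGauge.rbLocal E G = 0 ↔
      LeftInvariantGauge.AdmitsLeftInvariantLocallyFlat E G) := by
  open LeftInvariantGauge in
  simp only [rb, rbLocal, ENat.iInf_eq_zero, finrank_sub_eq_zero_iff]
  refine ⟨⟨fun ⟨D, h⟩ => ⟨D, D.2, isFlat_of_localSolutionSpan_eq_top D.2 ?_⟩,
    fun ⟨D, hD, hR⟩ => ⟨⟨D, hD⟩, solutionSpan_eq_top_of_isFlat hD hR⟩⟩,
    ⟨fun ⟨D, h⟩ => ⟨D, D.2, isFlat_of_localSolutionSpan_eq_top D.2 h⟩,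
    fun ⟨D, hD, hR⟩ => ⟨⟨D, hD⟩, ?_⟩⟩⟩
  · exact eq_top_iff.2 (h ▸ solutionSpan_le_localSolutionSpan)
  · exact eq_top_iff.2 (solutionSpan_eq_top_of_isFlat hD hR ▸ solutionSpan_le_localSolutionSpan)
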